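/- Let $G$ be a finite group and $\rho$ a unitary representation of $G$ on $\mathbb{C}^n$. For a finite set $I$ of fermion modes let $\mathcal{H}_F$ be the Fock space, with orthonormal basis $\psi^\dagger_{i_1}\cdots\psi^\dagger_{i_k}|\Omega\rangle$, $i_1<\dots<i_k$, generated from the vacuum $|\Omega\rangle$ by creation operators satisfying the canonical anticommutation relations with their adjoints $\psi_i$, and let $(-1)^F$ be the fermion parity. (1) The exterior algebra representation $\Lambda\rho=\bigoplus_k\Lambda^k\rho$ has character $\chi_{\Lambda\rho}(g)=\det(1+\rho(g))$. (2) Let $I=\{1,\dots,n\}$ and let $\sigma$ be a one-dimensional representation of $G$. There is exactly one unitary representation $\Gamma$ of $G$ on $\mathcal{H}_F$ with $\Gamma(g)\psi_a\Gamma(g)^{-1}=\sum_b\rho(g^{-1})_{ab}\psi_b$, $\Gamma(g)\psi^\dagger_a\Gamma(g)^{-1}=\sum_b\rho(g)_{ba}\psi_b^\dagger$ and $\Gamma(g)|\Omega\rangle=\sigma(g)|\Omega\rangle$. Under the identification $\psi^\dagger_{i_1}\cdots\psi^\dagger_{i_k}|\Omega\rangle\leftrightarrow e_{i_1}\wedge\dots\wedge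 e_{i_k}$ it is $\sigma\otimes\Lambda\rho$ (so it is $\Lambda\rho$ if the vacuum is invariant), and $$\operatorname{tr}\Gamma(g)=\sigma(g)\det(1+\rho(g)),\qquad \operatorname{tr}\big(\Gamma(g)(-1)^F\big)=\sigma(g)\det(1-\rho(g)).$$ (3) Consider a connected finite graph with $V\ge 1$ sites and $E$ oriented links (loops and multiple links allowed), with gauge field Hilbert space $\mathcal{H}_G=L^2(G^E)$ and fermions with $N_s$ spinor components in the representation $\rho$ at every site, i.e. modes $(x,s,a)$ with $x$ a site, $1\le s\le N_s$, $1\le a\le n$. Let $\tau$ be a one-dimensional representation of the group $G^V$ of gauge transformations and put $\sigma(g)=\tau(g,\dots,g)$. There is exactly one unitary representation $\Gamma$ of $G^V$ on $\mathcal{H}_F$ under which, for each gauge transformation $\{g_x\}$, the operators $\psi_{x,s,a},\psi^\dagger_{x,s,a}$ transform as in (2) with $\rho(g_x)$ acting on the gauge index $a$, and the vacuum transforms by $\tau$. It is $\tau\otimes\Lambda\big(\bigoplus_x 1_{N_s}\otimes\rho(g_x)\big)$, with $$\operatorname{tr}\Gamma(\{g_x\})=\tau(\{g_x\})\prod_x\det(1+\rho(g_x))^{N_s},\qquad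 \operatorname{tr}\big(\Gamma(\{g_x\})(-1)^F\big)=\tau(\{g_x\})\prod_x\det(1-\rho(g_x))^{N_s}.$$ Let $\mathcal{H}_{\mathrm{phys}}\subseteq\mathcal{H}_G\otimes\mathcal{H}_F$ be the subspace of vectors invariant under all gauge transformations, where $\{g_x\}$ acts on $\mathcal{H}_F$ by $\Gamma$ and on $\mathcal{H}_G$ by $|\{h_l\}\rangle\mapsto|\{g_xh_lg_y^{-1}\}\rangle$ for links $l$ from $x$ to $y$. Then, the sum being over the conjugacy classes $C$ of $G$, $$\dim\mathcal{H}_{\mathrm{phys}}=\sum_C\left(\frac{|G|}{|C|}\right)^{E-V}\sigma(C)\,\det(1+\rho(C))^{N_sV}.$$ If $\sigma(g)=\det\rho(g)^{-k}$ for all $g$, for some integer $0\le k\le N_sV$ (in particular for an invariant vacuum, $k=0$, and for the staggered vacuum, $N_s=1$, $V$ even, $k=V/2$), then $\mathcal{H}_{\mathrm{phys}}\neq 0$. -/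

import Mathlib

open scoped TensorProduct

noncomputable section

namespace FiniteGauge

/-! ### Fermionic Fock space -/

/-- The fermionic Fock space on a finite, linearly ordered set `I` of modes, in the occupation
number representation: the orthonormal basis vectors are indexed by the sets of occupied modes. -/
abbrev Fock (I : Type*) : Type _ := EuclideanSpace ℂ (Finset I)

section Operators

variable {I : Type*} [LinearOrder I]

/-- The sign `(-1)^#{j ∈ A | j < i}` picked up on moving the operator of mode `i` into place. -/
def jwSign (i : I) (A : Finset I) : ℂ := (-1) ^ (A.filter (· < i)).card

/-- The creation operator of mode `i`: it sends the basis state `|A⟩` to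
`(-1)^#{j ∈ A | j < i} |A ∪ {i}⟩` if `i ∉ A`, and to `0` if `i ∈ A`. -/
def create (i : I) : Fock I →ₗ[ℂ] Fock I where
  toFun v := WithLp.toLp 2 fun A => if i ∈ A then jwSign i A * v (A.erase i) else 0
  map_add' v w := by
    ext A
    by_cases h : i ∈ A <;> simp [h, mul_add]
  map_smul' c v := by
    ext A
    by_cases h : i ∈ A <;> simp [h, mul_left_comm]

/-- The annihilation operator of mode `i`: it sends `|A⟩` to
`(-1)^#{j ∈ A | j < i} |A \ {i}⟩` if `i ∈ A`, and to `0` if `i ∉ A`. -/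
def annihilate (i : I) : Fock I →ₗ[ℂ] Fock I where
  toFun v := WithLp.toLp 2 fun A => if i ∈ A then 0 else jwSign i A * v (insert i A)
  map_add' v w := by
    ext A
    by_cases h : i ∈ A <;> simp [h, mul_add]
  map_smul' c v := by
    ext A
    by_cases h : i ∈ A <;> simp [h, mul_left_comm]

/-- The Fock vacuum `|∅⟩`. -/
def vacuum : Fock I := EuclideanSpace.single ∅ 1

/-- Fermion parity `(-1)^F`, where `F` counts the occupied modes. -/
def parity : Fock I →ₗ[ℂ] Fock I where
  toFun v := WithLp.toLp 2 fun A => (-1) ^ A.card * v A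
  map_add' v w := by
    ext A
    simp [mul_add]
  map_smul' c v := by
    ext A
    simp [mul_left_comm]

variable [Fintype I] {K : Type*} [Group K]

/-- `Γ` is a unitary representation of `K` on Fock space that implements the transformation `U`
of the modes on the creation and annihilation operators, and under which the vacuum transforms
by the one-dimensional representation `τ`. -/
structure Implements (U : K → Matrix I I ℂ) (τ : K →* ℂˣ) (Γ : Representation ℂ K (Fock I)) :
    Prop where
  unitary : ∀ g v w, inner ℂ (Γ g v) (Γ g w) = inner ℂ v w
  annihilate_conj : ∀ g a, Γ g ∘ₗ annihilate a ∘ₗ Γ g⁻¹ = ∑ b, U g⁻¹ a b • annihilate b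
  create_conj : ∀ g a, Γ g ∘ₗ create a ∘ₗ Γ g⁻¹ = ∑ b, U g b a • create b
  vacuum_map : ∀ g, Γ g vacuum = (τ g : ℂ) • vacuum

/-- Under the identification `ψ†_{i₁} ⋯ ψ†_{iₖ} |Ω⟩ ↔ e_{i₁} ∧ ⋯ ∧ e_{iₖ}` of Fock space with the
exterior algebra, `Γ` becomes the exterior algebra representation `ΛU`, twisted by `τ`. -/
def IsExterior (U : K → Matrix I I ℂ) (τ : K →* ℂˣ) (Γ : Representation ℂ K (Fock I)) : Prop :=
  ∃ Φ : Fock I ≃ₗ[ℂ] ExteriorAlgebra ℂ (I → ℂ),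
    (∀ l : List I, Φ ((l.map create).prod vacuum) =
      (l.map fun i => ExteriorAlgebra.ι ℂ (Pi.single i (1 : ℂ))).prod) ∧
    ∀ g v, Φ (Γ g v) = (τ g : ℂ) • ExteriorAlgebra.map (Matrix.toLin' (U g)) (Φ v)

end Operators

/-- The representation on `ℂⁿ` given by unitary matrices. -/
def matrixRep {G : Type*} [Group G] {n : ℕ} (ρ : G →* Matrix.unitaryGroup (Fin n) ℂ) :
    Representation ℂ G (Fin n → ℂ) where
  toFun g := Matrix.toLin' (ρ g : Matrix (Fin n) (Fin n) ℂ)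
  map_one' := by simp [Module.End.one_eq_id]
  map_mul' g h := by simp [Matrix.toLin'_mul, Module.End.mul_eq_comp]

/-- The exterior algebra representation `Λρ = ⨁ₖ Λᵏρ`, acting by
`v₁ ∧ ⋯ ∧ vₖ ↦ ρ(g)v₁ ∧ ⋯ ∧ ρ(g)vₖ`. -/
def exteriorRep {G W : Type*} [Group G] [AddCommGroup W] [Module ℂ W] (ρ : Representation ℂ G W) :
    Representation ℂ G (ExteriorAlgebra ℂ W) where
  toFun g := (ExteriorAlgebra.map (ρ g)).toLinearMap
  map_one' := by
    rw [map_one, Module.End.one_eq_id, ExteriorAlgebra.map_id]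
    rfl
  map_mul' g h := by
    rw [map_mul, Module.End.mul_eq_comp, ← ExteriorAlgebra.map_comp_map]
    rfl

/-! ### Lattice gauge theory -/

/-- A lattice with sites `S` and links `L`: a graph with an arbitrary orientation of its links
(multiple links and loops are allowed). -/
structure Lattice (S L : Type*) where
  src : L → S
  tgt : L → S

variable {S L : Type*}

/-- A lattice is connected if it has a site and any two sites are joined by a path of links,
traversed in either direction. -/
def Lattice.Connected (X : Lattice S L) : Prop :=
  Nonempty S ∧ ∀ x y, Relation.EqvGen (fun a b => ∃ l, X.src l = a ∧ X.tgt l = b) x y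

/-- The Hilbert space of the gauge field: wave functions `G^L → ℂ`. -/
abbrev GaugeSpace (G L : Type*) : Type _ := EuclideanSpace ℂ (L → G)

/-- Gauge transformations of the gauge field, `|{h_l}⟩ ↦ |{g_x h_l g_y⁻¹}⟩` for links `l` from
`x` to `y`; on wave functions this is the pullback by the inverse. -/
def linkRep (G : Type*) [Group G] (X : Lattice S L) :
    Representation ℂ (S → G) (GaugeSpace G L) where
  toFun g :=
    { toFun := fun ψ =>
        WithLp.toLp 2 fun h => ψ fun l => (g (X.src l))⁻¹ * h l * g (X.tgt l)
      map_add' := fun _ _ => rfl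
      map_smul' := fun _ _ => rfl }
  map_one' := by
    ext ψ h
    simp
  map_mul' g g' := by
    ext ψ h
    simp [mul_assoc]

/-- The fermion modes of the lattice: a site, a spinor index and a gauge index. -/
abbrev Modes (S : Type*) (Ns n : ℕ) : Type _ := S ×ₗ (Fin Ns ×ₗ Fin n)

/-- The action of a gauge transformation on the classical fermion space: at the site `x` it is
`1 ⊗ ρ(g_x)` on spin ⊗ gauge. -/
def modeMatrix {G : Type*} [Group G] [DecidableEq S] {n : ℕ} (Ns : ℕ)
    (ρ : G →* Matrix.unitaryGroup (Fin n) ℂ) (g : S → G) :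
    Matrix (Modes S Ns n) (Modes S Ns n) ℂ :=
  fun p q =>
    let x := (ofLex p).1
    let s := (ofLex (ofLex p).2).1
    let a := (ofLex (ofLex p).2).2
    let y := (ofLex q).1
    let t := (ofLex (ofLex q).2).1
    let b := (ofLex (ofLex q).2).2
    if x = y ∧ s = t then (ρ (g x) : Matrix (Fin n) (Fin n) ℂ) a b else 0

/-- The physical Hilbert space: the gauge-invariant vectors of (gauge field) ⊗ (fermions). -/
def physicalSpace {G I : Type*} [Group G] (X : Lattice S L)
    (Γ : Representation ℂ (S → G) (Fock I)) :
    Submodule ℂ (GaugeSpace G L ⊗[ℂ] Fock I) :=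
  ((linkRep G X).tprod Γ).invariants

end FiniteGauge

end

open scoped TensorProduct

noncomputable section

namespace FiniteGauge

/-! ### The trace of an exterior algebra map -/

/-! `fockEquiv` identifies Fock space with the exterior algebra so that creation becomes left
multiplication by a basis vector. The vacuum is cyclic for the creation operators (`fock_hom_ext`),
so an implementing representation is determined by the vacuum and the creation relations;
transporting the exterior algebra map and twisting it by the vacuum character gives existence. The
annihilation relations then follow from the anticommutation relations, and unitarity from
adjointness (`inner_create`). The diagonal entries of an exterior algebra map are principal minors,
which sum to `det (1 + M)`; since parity is the second quantization of `-1`, the trace with parity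
is `det (1 - M)`.

The physical dimension is the average of a product of characters. The gauge field carries a
permutation representation: a link has a fixed value only if the gauge elements at its ends are
conjugate, and then there are `|G| / |C|` of them. On a connected lattice a single class `C`
therefore survives at all sites, with `|C| ^ V` choices of gauge elements.

For nonvanishing, filling `k` gauge multiplets gives a Fock state whose factor `det ^ k` cancels
that of the vacuum. Averaging it, tensored with the trivial link configuration, gives a physical
state (`finrank_physicalSpace_pos`). -/

/-- The determinant of `1 + M` is the sum of all principal minors of `M`. -/
theorem det_one_add_eq_sum_minors {I R : Type*} [Fintype I] [DecidableEq I] [CommRing R]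
    (M : Matrix I I R) :
    (1 + M).det = ∑ s : Finset I, (M.submatrix (Subtype.val : s → I) Subtype.val).det := by
  rw [add_comm]
  -- Expand by multilinearity in the rows: `s` records the rows taken from `M`, the others coming
  -- from the identity.
  change Matrix.detRowAlternating (M.row + (1 : Matrix I I R).row) = _
  rw [← AlternatingMap.coe_multilinearMap, MultilinearMap.map_add_univ]
  exact Finset.sum_congr rfl fun s _ => Matrix.det_piecewise_one_eq_submatrix_det M s

/-- The image of a basis vector is a wedge of columns of `M`, and its coordinates are determinants
of pairings with dual basis vectors. -/
theorem exteriorAlgebra_basis_repr_map_self {I R : Type*} [Fintype I] [LinearOrder I] [CommRing R]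
    (M : Matrix I I R) (s : Finset I) :
    (Pi.basisFun R I).ExteriorAlgebra.repr
        (ExteriorAlgebra.map M.toLin' ((Pi.basisFun R I).ExteriorAlgebra s)) s
      = (M.submatrix (Subtype.val : s → I) Subtype.val).det := by
  set b := Pi.basisFun R I
  let S : Set.powersetCard I s.card := Set.powersetCard.ofCard rfl
  -- On the summand of degree `s.card`, the coordinate at `s` agrees with that of the exterior
  -- power, where a determinant formula is available.
  have key : ∀ y : ⋀[R]^s.card (I → R),
      b.ExteriorAlgebra.repr (y : ExteriorAlgebra R (I → R)) s
        = (b.exteriorPower s.card).repr y S := by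
    refine LinearMap.congr_fun (f := b.ExteriorAlgebra.coord s ∘ₗ Submodule.subtype _)
      (g := (b.exteriorPower s.card).coord S) ((b.exteriorPower s.card).ext fun t => ?_)
    rw [LinearMap.comp_apply, Submodule.subtype_apply, ← ExteriorAlgebra.basis_eq_coe_basis,
      Module.Basis.coord_apply, Module.Basis.coord_apply, Module.Basis.repr_self,
      Module.Basis.repr_self]
    by_cases h : t = S
    · subst h; simp [S]
    · rw [Finsupp.single_eq_of_ne (Ne.symm h), Finsupp.single_eq_of_ne]
      exact fun h' => h (Subtype.ext h'.symm)
  have h1 : ExteriorAlgebra.map M.toLin' (b.ExteriorAlgebra s)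
      = ((exteriorPower.ιMulti R s.card
          (M.toLin' ∘ b ∘ Set.powersetCard.ofFinEmbEquiv.symm S) : ⋀[R]^s.card (I → R)) :
            ExteriorAlgebra R (I → R)) := by
    rw [ExteriorAlgebra.basis_apply_ofCard b rfl, ExteriorAlgebra.ιMulti_family,
      ExteriorAlgebra.map_apply_ιMulti]
    rfl
  rw [h1, key, exteriorPower.basis_repr_apply, exteriorPower.ιMultiDual_apply_ιMulti,
    ← Matrix.det_transpose, ← Matrix.det_submatrix_equiv_self (s.orderIsoOfFin rfl).toEquiv]
  congr 1
  ext i j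
  simp [b, S, Set.powersetCard.ofFinEmbEquiv_symm_apply, Pi.basisFun_apply]

theorem trace_exteriorAlgebra_map {I R : Type*} [Fintype I] [LinearOrder I] [CommRing R]
    (M : Matrix I I R) :
    LinearMap.trace R _ (ExteriorAlgebra.map M.toLin').toLinearMap = (1 + M).det := by
  rw [LinearMap.trace_eq_matrix_trace R (Pi.basisFun R I).ExteriorAlgebra,
    det_one_add_eq_sum_minors]
  refine Finset.sum_congr rfl fun s _ => ?_
  rw [Matrix.diag_apply, LinearMap.toMatrix_apply]
  exact exteriorAlgebra_basis_repr_map_self M s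

/-! ### Creation and annihilation operators -/

@[simp]
theorem parity_apply {I : Type*} (v : Fock I) (A : Finset I) :
    parity v A = (-1) ^ A.card * v A := rfl

section Operators

variable {I : Type*} [LinearOrder I]

@[simp]
theorem create_apply (i : I) (v : Fock I) (A : Finset I) :
    create i v A = if i ∈ A then jwSign i A * v (A.erase i) else 0 := rfl

@[simp]
theorem annihilate_apply (i : I) (v : Fock I) (A : Finset I) :
    annihilate i v A = if i ∈ A then 0 else jwSign i A * v (insert i A) := rfl

theorem jwSign_mul_self (i : I) (A : Finset I) : jwSign i A * jwSign i A = 1 := by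
  rw [jwSign, ← mul_pow]; simp

theorem star_jwSign (i : I) (A : Finset I) : star (jwSign i A) = jwSign i A := by
  simp [jwSign]

theorem jwSign_erase_self (i : I) (A : Finset I) : jwSign i (A.erase i) = jwSign i A := by
  rw [jwSign, jwSign, Finset.filter_erase, Finset.erase_eq_of_notMem (by simp)]

theorem jwSign_insert_self (i : I) (A : Finset I) : jwSign i (insert i A) = jwSign i A := by
  simp [jwSign, Finset.filter_insert]

theorem jwSign_erase (i j : I) {A : Finset I} (h : j ∈ A) :
    jwSign i (A.erase j) = if j < i then - jwSign i A else jwSign i A := by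
  rw [jwSign, jwSign, Finset.filter_erase]
  split_ifs with hji
  · have hm : j ∈ A.filter (· < i) := by simp [h, hji]
    rw [← Finset.card_erase_add_one hm, pow_succ]; ring
  · rw [Finset.erase_eq_of_notMem (by simp [hji])]

theorem jwSign_insert (i j : I) {A : Finset I} (h : j ∉ A) :
    jwSign i (insert j A) = if j < i then - jwSign i A else jwSign i A := by
  have := jwSign_erase i j (Finset.mem_insert_self j A)
  rw [Finset.erase_insert h] at this
  split_ifs at this ⊢ <;> simp [this]

/-- Removing a mode flips the sign of another exactly when it precedes it, so for `i ≠ j` the two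
orders differ by one minus sign. -/
theorem create_mul_create_add (i j : I) (v : Fock I) :
    create i (create j v) + create j (create i v) = 0 := by
  ext A
  rcases eq_or_ne i j with rfl | hij
  · simp
  by_cases hi : i ∈ A <;> by_cases hj : j ∈ A <;> simp [hi, hj, hij, hij.symm]
  rw [jwSign_erase j i hi, jwSign_erase i j hj, Finset.erase_right_comm]
  rcases lt_or_gt_of_ne hij with h | h <;> simp [h, h.not_gt] <;> ring

theorem annihilate_create_add (i j : I) (v : Fock I) :
    annihilate i (create j v) + create j (annihilate i v) = if i = j then v else 0 := by
  ext A
  rcases eq_or_ne i j with rfl | hij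
  · by_cases hi : i ∈ A
    · simp [hi, jwSign_erase_self, ← mul_assoc, jwSign_mul_self]
    · simp [hi, jwSign_insert_self, ← mul_assoc, jwSign_mul_self]
  by_cases hi : i ∈ A <;> by_cases hj : j ∈ A <;> simp [hi, hj, hij, hij.symm]
  rw [jwSign_insert j i hi, jwSign_erase i j hj, Finset.erase_insert_of_ne hij]
  rcases lt_or_gt_of_ne hij with h | h <;> simp [h, h.not_gt] <;> ring

theorem parity_create (i : I) (v : Fock I) : parity (create i v) = - create i (parity v) := by
  ext A
  by_cases hi : i ∈ A
  · rw [parity_apply, create_apply, PiLp.neg_apply, create_apply, parity_apply,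
      ← Finset.card_erase_add_one hi, pow_succ]
    simp [hi]
    ring
  · simp [hi]

theorem annihilate_vacuum (i : I) : annihilate i (vacuum : Fock I) = 0 := by
  ext A
  simp [vacuum]

theorem create_single (i : I) {A : Finset I} (h : i ∉ A) :
    create i (EuclideanSpace.single A 1) = jwSign i A • EuclideanSpace.single (insert i A) 1 := by
  ext B
  by_cases hB : B = insert i A
  · subst hB
    simp [jwSign_insert_self, h]
  · by_cases hi : i ∈ B
    · have : B.erase i ≠ A := fun h' => hB (by rw [← h', Finset.insert_erase hi])
      simp [hB, hi, this]
    · simp [hB, hi]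

theorem create_single_of_forall_lt {i : I} {A : Finset I} (h : ∀ j ∈ A, i < j) :
    create i (EuclideanSpace.single A 1) = EuclideanSpace.single (insert i A) 1 := by
  rw [create_single i fun hi => (h i hi).false, jwSign, Finset.filter_false_of_mem]
  · simp
  · exact fun j hj => (h j hj).not_gt

theorem prod_create_vacuum_of_pairwise_lt {l : List I} (h : l.Pairwise (· < ·)) :
    (l.map create).prod vacuum = EuclideanSpace.single l.toFinset 1 := by
  induction l with
  | nil => rfl
  | cons i l ih =>
    rw [List.pairwise_cons] at h
    rw [List.map_cons, List.prod_cons, Module.End.mul_apply, ih h.2,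
      create_single_of_forall_lt (by simpa using h.1), List.toFinset_cons]

theorem prod_create_vacuum_ne_zero {l : List I} (h : l.Nodup) :
    (l.map create).prod vacuum ≠ 0 := by
  suffices ∃ c : ℂ, c ≠ 0 ∧ (l.map create).prod vacuum = c • EuclideanSpace.single l.toFinset 1 by
    obtain ⟨c, hc, h⟩ := this
    rw [h]
    simpa using hc
  induction l with
  | nil => exact ⟨1, one_ne_zero, by simp [vacuum]⟩
  | cons i l ih =>
    rw [List.nodup_cons] at h
    obtain ⟨c, hc, hl⟩ := ih h.2
    refine ⟨c * jwSign i l.toFinset, mul_ne_zero hc (by simp [jwSign]), ?_⟩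
    rw [List.map_cons, List.prod_cons, Module.End.mul_apply, hl, map_smul,
      create_single i (by simpa using h.1), List.toFinset_cons, smul_smul]

variable [Fintype I]

theorem span_single_eq_top :
    Submodule.span ℂ (Set.range fun A : Finset I => (EuclideanSpace.single A 1 : Fock I)) = ⊤ := by
  have := (EuclideanSpace.basisFun (Finset I) ℂ).toBasis.span_eq
  rw [← this]
  congr 2
  ext A
  simp

/-- The vacuum is cyclic for the creation operators. -/
theorem eq_top_of_vacuum_mem {p : Submodule ℂ (Fock I)} (h0 : vacuum ∈ p)
    (hc : ∀ i, ∀ v ∈ p, create i v ∈ p) : p = ⊤ := by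
  rw [eq_top_iff, ← span_single_eq_top, Submodule.span_le]
  rintro _ ⟨A, rfl⟩
  -- Each inserted mode lies below those already present, so no sign arises.
  induction A using Finset.induction_on_min with
  | empty => exact h0
  | insert i A h ih =>
    simp only [SetLike.mem_coe] at ih ⊢
    rw [← create_single_of_forall_lt h]
    exact hc i _ ih

/-- Two linear maps are equal if they agree on the vacuum and their equality is inherited under the
creation operators. -/
theorem fock_hom_ext {W : Type*} [AddCommGroup W] [Module ℂ W] {f g : Fock I →ₗ[ℂ] W}
    (h0 : f vacuum = g vacuum) (hc : ∀ i v, f v = g v → f (create i v) = g (create i v)) :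
    f = g := by
  rw [← LinearMap.eqLocus_eq_top]
  exact eq_top_of_vacuum_mem h0 hc

/-- Erasing `i` matches the sets containing `i` with those avoiding it, and the real sign does not
depend on whether `i` is occupied. -/
theorem inner_create (i : I) (v w : Fock I) :
    inner ℂ v (create i w) = inner ℂ (annihilate i v) w := by
  simp only [PiLp.inner_apply, create_apply, annihilate_apply, RCLike.inner_apply]
  simp only [ite_mul, mul_ite, zero_mul, mul_zero, apply_ite (starRingEnd ℂ), map_zero]
  rw [← Finset.sum_filter]
  simp only [← ite_not (p := i ∈ _)]
  rw [← Finset.sum_filter]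
  refine Finset.sum_bij' (fun A _ => A.erase i) (fun A _ => insert i A) ?_ ?_ ?_ ?_ ?_
  · intro A hA; simp
  · intro A hA; simp
  · intro A hA; simp at hA; simp [hA]
  · intro A hA; simp at hA; simp [hA]
  · intro A hA
    simp at hA
    have := star_jwSign i A
    simp [hA, jwSign_erase_self]
    simp only [starRingEnd_apply, this]
    ring

end Operators

/-! ### Fock space as an exterior algebra -/

section SecondQuantization

variable {I : Type*} [LinearOrder I] [Fintype I]

/-- The creation operator `∑ᵢ vᵢ ψ†ᵢ` of a one-particle state `v`. -/
def createVec : (I → ℂ) →ₗ[ℂ] Module.End ℂ (Fock I) :=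
  ∑ i, (LinearMap.proj i : (I → ℂ) →ₗ[ℂ] ℂ).smulRight (create i)

theorem createVec_apply (v : I → ℂ) :
    createVec v = ∑ i, v i • (create i : Module.End ℂ (Fock I)) := by
  simp [createVec]

theorem createVec_single (i : I) : createVec (Pi.single i 1) = create i := by
  simp [createVec_apply, Pi.single_apply, ite_smul]

theorem createVec_mul_self (v : I → ℂ) : createVec v * createVec v = 0 := by
  -- Doubling symmetrizes the double sum, so that anticommutation cancels it term by term.
  have h : createVec v * createVec v + createVec v * createVec v = 0 := by
    rw [createVec_apply, Finset.sum_mul_sum]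
    nth_rw 2 [Finset.sum_comm]
    simp only [← Finset.sum_add_distrib]
    refine Finset.sum_eq_zero fun i _ => Finset.sum_eq_zero fun j _ => ?_
    refine LinearMap.ext fun w => ?_
    have := congrArg (fun x => (v i * v j) • x) (create_mul_create_add i j w)
    simpa [smul_smul, mul_comm (v j)] using this
  rw [← two_smul ℂ, smul_eq_zero] at h
  exact h.resolve_left two_ne_zero

/-- The action of the exterior algebra on Fock space by creation operators. -/
def createAlg : ExteriorAlgebra ℂ (I → ℂ) →ₐ[ℂ] Module.End ℂ (Fock I) :=
  ExteriorAlgebra.lift ℂ ⟨createVec, createVec_mul_self⟩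

theorem createAlg_ι (v : I → ℂ) : createAlg (ExteriorAlgebra.ι ℂ v) = createVec v :=
  ExteriorAlgebra.lift_ι_apply ℂ _ _ _

/-- The identification of Fock space with the exterior algebra. -/
def fockEquiv : Fock I ≃ₗ[ℂ] ExteriorAlgebra ℂ (I → ℂ) :=
  (EuclideanSpace.basisFun (Finset I) ℂ).toBasis.equiv (Pi.basisFun ℂ I).ExteriorAlgebra
    (Equiv.refl _)

theorem fockEquiv_single (A : Finset I) :
    fockEquiv (EuclideanSpace.single A 1) = (Pi.basisFun ℂ I).ExteriorAlgebra A := by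
  have := (EuclideanSpace.basisFun (Finset I) ℂ).toBasis.equiv_apply A
    (Pi.basisFun ℂ I).ExteriorAlgebra (Equiv.refl _)
  simpa [fockEquiv] using this

theorem createAlg_basis_vacuum (A : Finset I) :
    createAlg ((Pi.basisFun ℂ I).ExteriorAlgebra A) vacuum = EuclideanSpace.single A 1 := by
  have h : createAlg ((Pi.basisFun ℂ I).ExteriorAlgebra A) = ((A.sort).map create).prod := by
    rw [ExteriorAlgebra.basis_apply_ofCard _ rfl, ExteriorAlgebra.ιMulti_family,
      ExteriorAlgebra.ιMulti_apply, map_list_prod, List.map_ofFn,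
      ← Finset.listMap_orderEmbOfFin_finRange A rfl, List.map_map, List.ofFn_eq_map]
    congr 2
    ext1 k
    simp [createAlg_ι, createVec_single, Set.powersetCard.ofFinEmbEquiv_symm_apply]
  rw [h, prod_create_vacuum_of_pairwise_lt (Finset.sortedLT_sort A).pairwise,
    Finset.sort_toFinset]

/-- `fockEquiv` is defined only by matching bases; describing its inverse as the orbit map of the
vacuum makes it compatible with products. -/
theorem fockEquiv_symm_apply (x : ExteriorAlgebra ℂ (I → ℂ)) :
    fockEquiv.symm x = createAlg x vacuum := by
  refine LinearMap.congr_fun (f := fockEquiv.symm.toLinearMap)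
    (g := LinearMap.applyₗ vacuum ∘ₗ createAlg.toLinearMap)
    ((Pi.basisFun ℂ I).ExteriorAlgebra.ext fun A => ?_) x
  simp only [LinearEquiv.coe_coe, LinearMap.comp_apply, AlgHom.toLinearMap_apply,
    LinearMap.applyₗ_apply_apply, createAlg_basis_vacuum]
  rw [← fockEquiv_single, LinearEquiv.symm_apply_apply]

theorem fockEquiv_vacuum : fockEquiv (vacuum : Fock I) = 1 := by
  rw [← LinearEquiv.eq_symm_apply, fockEquiv_symm_apply, map_one, Module.End.one_apply]

theorem fockEquiv_createVec (u : I → ℂ) (v : Fock I) :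
    fockEquiv (createVec u v) = ExteriorAlgebra.ι ℂ u * fockEquiv v := by
  rw [← LinearEquiv.eq_symm_apply, fockEquiv_symm_apply, map_mul, createAlg_ι,
    Module.End.mul_apply, ← fockEquiv_symm_apply, LinearEquiv.symm_apply_apply]

theorem fockEquiv_create (i : I) (v : Fock I) :
    fockEquiv (create i v) = ExteriorAlgebra.ι ℂ (Pi.single i 1) * fockEquiv v := by
  rw [← createVec_single, fockEquiv_createVec]

theorem fockEquiv_prod_create (l : List I) :
    fockEquiv ((l.map create).prod vacuum)
      = (l.map fun i => ExteriorAlgebra.ι ℂ (Pi.single i (1 : ℂ))).prod := by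
  induction l with
  | nil => exact fockEquiv_vacuum
  | cons i l ih => simp [Module.End.mul_apply, fockEquiv_create, ih]

/-- The operator on Fock space induced by an operator on one-particle states. -/
def secondQuantize (U : Matrix I I ℂ) : Fock I →ₗ[ℂ] Fock I :=
  fockEquiv.symm.toLinearMap ∘ₗ (ExteriorAlgebra.map U.toLin').toLinearMap ∘ₗ fockEquiv.toLinearMap

theorem fockEquiv_secondQuantize (U : Matrix I I ℂ) (v : Fock I) :
    fockEquiv (secondQuantize U v) = ExteriorAlgebra.map U.toLin' (fockEquiv v) := by
  simp [secondQuantize]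

theorem secondQuantize_vacuum (U : Matrix I I ℂ) : secondQuantize U vacuum = vacuum := by
  apply fockEquiv.injective
  rw [fockEquiv_secondQuantize, fockEquiv_vacuum, map_one]

theorem secondQuantize_create (U : Matrix I I ℂ) (a : I) (v : Fock I) :
    secondQuantize U (create a v) = ∑ b, U b a • create b (secondQuantize U v) := by
  have h : secondQuantize U (create a v) = createVec (U.toLin' (Pi.single a 1))
      (secondQuantize U v) := by
    apply fockEquiv.injective
    rw [fockEquiv_secondQuantize, fockEquiv_create, map_mul, ExteriorAlgebra.map_apply_ι,
      fockEquiv_createVec, fockEquiv_secondQuantize]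
  rw [h, createVec_apply]
  simp [LinearMap.sum_apply]

theorem secondQuantize_one : secondQuantize (1 : Matrix I I ℂ) = LinearMap.id := by
  ext1 v
  apply fockEquiv.injective
  simp [fockEquiv_secondQuantize]

theorem secondQuantize_mul (U V : Matrix I I ℂ) :
    secondQuantize (U * V) = secondQuantize U ∘ₗ secondQuantize V := by
  ext1 v
  apply fockEquiv.injective
  rw [LinearMap.comp_apply, fockEquiv_secondQuantize, fockEquiv_secondQuantize,
    fockEquiv_secondQuantize, Matrix.toLin'_mul, ← ExteriorAlgebra.map_comp_map]
  rfl

/-- This lets parity be absorbed into the one-particle matrix, reducing the trace with parity to the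
ordinary trace. -/
theorem secondQuantize_neg_one : secondQuantize (-1 : Matrix I I ℂ) = parity := by
  refine fock_hom_ext ?_ fun i v h => ?_
  · rw [secondQuantize_vacuum]
    ext A
    by_cases hA : A = ∅ <;> simp [vacuum, hA]
  · rw [secondQuantize_create, parity_create, h]
    simp [Matrix.one_apply, ite_smul]

theorem trace_secondQuantize (U : Matrix I I ℂ) :
    LinearMap.trace ℂ _ (secondQuantize U) = (1 + U).det := by
  rw [← trace_exteriorAlgebra_map]
  have h : secondQuantize U
      = fockEquiv.symm.conj (ExteriorAlgebra.map U.toLin').toLinearMap := by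
    rw [LinearEquiv.conj_apply, LinearEquiv.symm_symm]
    rfl
  rw [h, LinearMap.trace_conj']

theorem trace_secondQuantize_parity (U : Matrix I I ℂ) :
    LinearMap.trace ℂ _ (secondQuantize U ∘ₗ parity) = (1 - U).det := by
  rw [← secondQuantize_neg_one, ← secondQuantize_mul, trace_secondQuantize, mul_neg, mul_one,
    sub_eq_add_neg]

/-- Both sides kill the vacuum. Moving annihilation past a creation operator propagates the
identity, the contraction terms matching because `V * U = 1`. -/
theorem secondQuantize_annihilate {U V : Matrix I I ℂ} (h : V * U = 1) (a : I) (v : Fock I) :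
    secondQuantize U (annihilate a v) = ∑ b, V a b • annihilate b (secondQuantize U v) := by
  suffices secondQuantize U ∘ₗ annihilate a = (∑ b, V a b • annihilate b) ∘ₗ secondQuantize U by
    simpa [LinearMap.sum_apply] using LinearMap.congr_fun this v
  refine fock_hom_ext ?_ fun c v hv => ?_
  · simp [secondQuantize_vacuum, annihilate_vacuum]
  · simp only [LinearMap.comp_apply, LinearMap.sum_apply, LinearMap.smul_apply] at hv ⊢
    have car : ∀ (i j : I) (w : Fock I),
        annihilate i (create j w) = (if i = j then w else 0) - create j (annihilate i w) :=
      fun i j w => eq_sub_of_add_eq (annihilate_create_add i j w)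
    have hVU : ∀ w : Fock I, ∑ b, ∑ d, V a b • U d c • (if b = d then w else 0)
        = if a = c then w else 0 := by
      intro w
      have := congrFun (congrFun h a) c
      rw [Matrix.mul_apply, Matrix.one_apply] at this
      simp only [smul_ite, smul_zero, Finset.sum_ite_eq, Finset.mem_univ, if_true, smul_smul,
        ← Finset.sum_smul, this]
      split_ifs <;> simp
    rw [car, map_sub, secondQuantize_create, secondQuantize_create, hv]
    simp only [map_sum, map_smul, car, smul_sub, Finset.smul_sum, Finset.sum_sub_distrib, hVU]
    congr 1
    · split_ifs <;> simp
    · rw [Finset.sum_comm]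
      simp only [smul_comm (V a _)]

theorem inner_secondQuantize {U : Matrix I I ℂ} (h : U.conjTranspose * U = 1) (v w : Fock I) :
    inner ℂ (secondQuantize U v) (secondQuantize U w) = inner ℂ v w := by
  have hvac : ∀ v : Fock I, inner ℂ v (vacuum : Fock I) = starRingEnd ℂ (v ∅) := by
    intro v
    simp [vacuum, EuclideanSpace.inner_single_right]
  -- A created state has no vacuum component, so only the vacuum itself contributes here.
  have hempty : ∀ v : Fock I, secondQuantize U v ∅ = v ∅ := by
    let ev : Fock I →ₗ[ℂ] ℂ := (EuclideanSpace.proj ∅ : Fock I →L[ℂ] ℂ).toLinearMap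
    refine LinearMap.congr_fun (f := ev ∘ₗ secondQuantize U) (g := ev) (fock_hom_ext ?_ ?_)
    · simp [ev, secondQuantize_vacuum]
    · intro i v _
      simp [ev, secondQuantize_create]
  -- The condition ranges over all `v`, since moving a creation operator across the inner product
  -- replaces `v` by `annihilate i v`.
  let p : Submodule ℂ (Fock I) :=
    { carrier := {w | ∀ v, inner ℂ (secondQuantize U v) (secondQuantize U w) = inner ℂ v w}
      add_mem' := fun {x y} hx hy v => by rw [map_add, inner_add_right, inner_add_right, hx, hy]
      zero_mem' := fun v => by simp
      smul_mem' := fun c x hx v => by rw [map_smul, inner_smul_right, inner_smul_right, hx] }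
  suffices p = ⊤ from (this ▸ Submodule.mem_top : w ∈ p) v
  refine eq_top_of_vacuum_mem (fun v => ?_) fun i w hw v => ?_
  · rw [secondQuantize_vacuum, hvac, hvac, hempty]
  · rw [inner_create, ← hw, secondQuantize_annihilate h, secondQuantize_create, inner_sum,
      sum_inner]
    refine Finset.sum_congr rfl fun b _ => ?_
    rw [inner_smul_right, inner_smul_left, inner_create, Matrix.conjTranspose_apply,
      starRingEnd_apply, star_star]

end SecondQuantization

/-! ### The representation on Fock space implementing a transformation of the modes -/

section FockRep

variable {I : Type*} [LinearOrder I] [Fintype I] {K : Type*} [Group K]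

/-- The exterior algebra representation on Fock space, twisted by `τ`. -/
def fockRep (U : K →* Matrix.unitaryGroup I ℂ) (τ : K →* ℂˣ) : Representation ℂ K (Fock I) where
  toFun g := (τ g : ℂ) • secondQuantize (U g : Matrix I I ℂ)
  map_one' := by
    simp [secondQuantize_one, Module.End.one_eq_id]
  map_mul' g h := by
    ext1 v
    simp only [map_mul, Units.val_mul, Submonoid.coe_mul, secondQuantize_mul, mul_smul,
      Module.End.mul_apply, LinearMap.smul_apply, LinearMap.comp_apply, map_smul]
    exact smul_comm _ _ _

theorem fockRep_apply (U : K →* Matrix.unitaryGroup I ℂ) (τ : K →* ℂˣ) (g : K) (v : Fock I) :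
    fockRep U τ g v = (τ g : ℂ) • secondQuantize (U g : Matrix I I ℂ) v := rfl

theorem norm_character_eq_one [Finite K] (τ : K →* ℂˣ) (g : K) : ‖(τ g : ℂ)‖ = 1 := by
  refine Complex.norm_eq_one_of_pow_eq_one (n := Nat.card K) ?_ Nat.card_pos.ne'
  rw [← Units.val_pow_eq_pow_val, ← map_pow, pow_card_eq_one', map_one, Units.val_one]

theorem implements_fockRep [Finite K] (U : K →* Matrix.unitaryGroup I ℂ) (τ : K →* ℂˣ) :
    Implements (fun g => (U g : Matrix I I ℂ)) τ (fockRep U τ) := by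
  have hinv : ∀ g v, (τ g : ℂ) • secondQuantize (U g : Matrix I I ℂ) (fockRep U τ g⁻¹ v) = v := by
    intro g v
    rw [← fockRep_apply, Representation.self_inv_apply]
  refine ⟨fun g v w => ?_, fun g a => ?_, fun g a => ?_, fun g => ?_⟩
  · rw [fockRep_apply, fockRep_apply, inner_smul_left, inner_smul_right,
      inner_secondQuantize (Matrix.mem_unitaryGroup_iff'.1 (U g).2), ← mul_assoc,
      RCLike.conj_mul, norm_character_eq_one]
    simp
  · have hU : (U g⁻¹ : Matrix I I ℂ) * U g = 1 := by
      rw [← Submonoid.coe_mul, ← map_mul, inv_mul_cancel, map_one]; rfl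
    ext1 v
    simp only [LinearMap.comp_apply, LinearMap.sum_apply, LinearMap.smul_apply]
    rw [fockRep_apply, secondQuantize_annihilate hU]
    simp only [Finset.smul_sum, ← map_smul, hinv]
  · ext1 v
    simp only [LinearMap.comp_apply, LinearMap.sum_apply, LinearMap.smul_apply]
    rw [fockRep_apply, secondQuantize_create]
    simp only [Finset.smul_sum, ← map_smul, hinv]
  · rw [fockRep_apply, secondQuantize_vacuum]

/-- The creation relation, evaluated at `Γ g v`, determines `Γ g` on `create i v` from its value on
`v`; cyclicity of the vacuum does the rest. -/
theorem Implements.eq_fockRep {U : K →* Matrix.unitaryGroup I ℂ} {τ : K →* ℂˣ}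
    {Γ : Representation ℂ K (Fock I)} (h : Implements (fun g => (U g : Matrix I I ℂ)) τ Γ) :
    Γ = fockRep U τ := by
  refine MonoidHom.ext fun g => fock_hom_ext ?_ fun i v hv => ?_
  · rw [h.vacuum_map, fockRep_apply, secondQuantize_vacuum]
  · have hc := LinearMap.congr_fun (h.create_conj g i) (Γ g v)
    simp only [LinearMap.comp_apply, LinearMap.sum_apply, LinearMap.smul_apply,
      Representation.inv_self_apply] at hc
    rw [hc, fockRep_apply, secondQuantize_create, hv, fockRep_apply]
    simp only [Finset.smul_sum, map_smul, smul_comm (τ g : ℂ)]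

theorem existsUnique_implements [Finite K] (U : K →* Matrix.unitaryGroup I ℂ) (τ : K →* ℂˣ) :
    ∃! Γ : Representation ℂ K (Fock I), Implements (fun g => (U g : Matrix I I ℂ)) τ Γ :=
  ⟨fockRep U τ, implements_fockRep U τ, fun _ h => h.eq_fockRep⟩

theorem isExterior_fockRep (U : K →* Matrix.unitaryGroup I ℂ) (τ : K →* ℂˣ) :
    IsExterior (fun g => (U g : Matrix I I ℂ)) τ (fockRep U τ) := by
  refine ⟨fockEquiv, fockEquiv_prod_create, fun g v => ?_⟩
  rw [fockRep_apply, map_smul, fockEquiv_secondQuantize]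

theorem trace_fockRep (U : K →* Matrix.unitaryGroup I ℂ) (τ : K →* ℂˣ) (g : K) :
    LinearMap.trace ℂ _ (fockRep U τ g) = τ g * (1 + (U g : Matrix I I ℂ)).det := by
  rw [← trace_secondQuantize, ← smul_eq_mul, ← map_smul]
  rfl

theorem trace_fockRep_parity (U : K →* Matrix.unitaryGroup I ℂ) (τ : K →* ℂˣ) (g : K) :
    LinearMap.trace ℂ _ (fockRep U τ g ∘ₗ parity) = τ g * (1 - (U g : Matrix I I ℂ)).det := by
  rw [← trace_secondQuantize_parity, ← smul_eq_mul, ← map_smul]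
  rfl

end FockRep

/-! ### The action of gauge transformations on the fermions of the lattice -/

section Modes

/-- The equivalence of modes with triples, gauge index first. -/
def modesEquiv (S : Type*) (Ns n : ℕ) : Modes S Ns n ≃ Fin n × (S × Fin Ns) where
  toFun p := ((ofLex (ofLex p).2).2, ((ofLex p).1, (ofLex (ofLex p).2).1))
  invFun q := toLex (q.2.1, toLex (q.2.2, q.1))
  left_inv _ := rfl
  right_inv _ := rfl

@[simp]
theorem modesEquiv_apply {S : Type*} {Ns n : ℕ} (p : Modes S Ns n) :
    modesEquiv S Ns n p = ((ofLex (ofLex p).2).2, ((ofLex p).1, (ofLex (ofLex p).2).1)) := rfl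

/-- The action of a gauge transformation on the modes, as a reindexed block diagonal matrix. -/
theorem modeMatrix_eq_submatrix {G S : Type*} [Group G] [DecidableEq S] {n : ℕ} (Ns : ℕ)
    (ρ : G →* Matrix.unitaryGroup (Fin n) ℂ) (g : S → G) :
    modeMatrix Ns ρ g = (Matrix.blockDiagonal fun p : S × Fin Ns =>
      (ρ (g p.1) : Matrix (Fin n) (Fin n) ℂ)).submatrix
        (modesEquiv S Ns n) (modesEquiv S Ns n) := by
  ext p q
  simp [modeMatrix, Matrix.blockDiagonal_apply]

variable {G S : Type*} [Group G] [Fintype S] [LinearOrder S] {n : ℕ}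

/-- The unitary representation of the gauge transformations on the modes. -/
def modeRep (S : Type*) [Fintype S] [LinearOrder S] (Ns : ℕ)
    (ρ : G →* Matrix.unitaryGroup (Fin n) ℂ) :
    (S → G) →* Matrix.unitaryGroup (Modes S Ns n) ℂ where
  toFun g := ⟨modeMatrix Ns ρ g, by
    rw [Matrix.mem_unitaryGroup_iff', Matrix.star_eq_conjTranspose, modeMatrix_eq_submatrix]
    rw [Matrix.conjTranspose_submatrix, Matrix.submatrix_mul_equiv,
      Matrix.blockDiagonal_conjTranspose, ← Matrix.blockDiagonal_mul]
    have : (fun p : S × Fin Ns => (ρ (g p.1) : Matrix (Fin n) (Fin n) ℂ).conjTranspose *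
        (ρ (g p.1) : Matrix (Fin n) (Fin n) ℂ)) = 1 := by
      ext1 p
      exact Matrix.mem_unitaryGroup_iff'.1 (ρ (g p.1)).2
    rw [this, Matrix.blockDiagonal_one, Matrix.submatrix_one_equiv]⟩
  map_one' := by
    apply Subtype.ext
    change modeMatrix Ns ρ 1 = 1
    rw [modeMatrix_eq_submatrix]
    simp only [Pi.one_apply, map_one, Submonoid.coe_one]
    rw [← Pi.one_def, Matrix.blockDiagonal_one, Matrix.submatrix_one_equiv]
  map_mul' g h := by
    apply Subtype.ext
    change modeMatrix Ns ρ (g * h) = modeMatrix Ns ρ g * modeMatrix Ns ρ h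
    rw [modeMatrix_eq_submatrix, modeMatrix_eq_submatrix, modeMatrix_eq_submatrix]
    rw [Matrix.submatrix_mul_equiv, ← Matrix.blockDiagonal_mul]
    simp

@[simp]
theorem coe_modeRep (Ns : ℕ) (ρ : G →* Matrix.unitaryGroup (Fin n) ℂ) (g : S → G) :
    (modeRep S Ns ρ g : Matrix (Modes S Ns n) (Modes S Ns n) ℂ) = modeMatrix Ns ρ g := rfl

/-- The scalar serves both traces: `c = 1` for the plain one and `c = -1` for the one with parity.
-/
theorem det_one_add_smul_modeMatrix (Ns : ℕ) (ρ : G →* Matrix.unitaryGroup (Fin n) ℂ) (g : S → G)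
    (c : ℂ) :
    (1 + c • modeMatrix Ns ρ g).det
      = ∏ x, (1 + c • (ρ (g x) : Matrix (Fin n) (Fin n) ℂ)).det ^ Ns := by
  have h : 1 + c • modeMatrix Ns ρ g = (Matrix.blockDiagonal fun p : S × Fin Ns =>
      1 + c • (ρ (g p.1) : Matrix (Fin n) (Fin n) ℂ)).submatrix
        (modesEquiv S Ns n) (modesEquiv S Ns n) := by
    have h1 : (fun p : S × Fin Ns => 1 + c • (ρ (g p.1) : Matrix (Fin n) (Fin n) ℂ))
        = 1 + c • fun p : S × Fin Ns => (ρ (g p.1) : Matrix (Fin n) (Fin n) ℂ) := rfl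
    rw [h1, Matrix.blockDiagonal_add, Matrix.blockDiagonal_one, Matrix.blockDiagonal_smul,
      Matrix.submatrix_add, Matrix.submatrix_smul, modeMatrix_eq_submatrix]
    simp only [Pi.add_apply, Pi.smul_apply]
    rw [Matrix.submatrix_one_equiv]
  rw [h, Matrix.det_submatrix_equiv_self, Matrix.det_blockDiagonal, Fintype.prod_prod_type]
  simp

theorem trace_fockRep_modeRep (Ns : ℕ) (ρ : G →* Matrix.unitaryGroup (Fin n) ℂ)
    (τ : (S → G) →* ℂˣ) (g : S → G) :
    LinearMap.trace ℂ _ (fockRep (modeRep S Ns ρ) τ g)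
      = τ g * ∏ x, (1 + (ρ (g x) : Matrix (Fin n) (Fin n) ℂ)).det ^ Ns := by
  rw [trace_fockRep, coe_modeRep]
  have := det_one_add_smul_modeMatrix Ns ρ g 1
  simp only [one_smul] at this
  rw [this]

theorem trace_fockRep_modeRep_parity (Ns : ℕ) (ρ : G →* Matrix.unitaryGroup (Fin n) ℂ)
    (τ : (S → G) →* ℂˣ) (g : S → G) :
    LinearMap.trace ℂ _ (fockRep (modeRep S Ns ρ) τ g ∘ₗ parity)
      = τ g * ∏ x, (1 - (ρ (g x) : Matrix (Fin n) (Fin n) ℂ)).det ^ Ns := by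
  rw [trace_fockRep_parity, coe_modeRep]
  have := det_one_add_smul_modeMatrix Ns ρ g (-1)
  simp only [neg_one_smul, ← sub_eq_add_neg] at this
  rw [this]

end Modes

/-! ### The character of the gauge field representation -/

section Links

variable {G : Type*} [Group G] {S L : Type*}

theorem linkRep_apply (X : Lattice S L) (g : S → G) (ψ : GaugeSpace G L) (h : L → G) :
    linkRep G X g ψ h = ψ fun l => (g (X.src l))⁻¹ * h l * g (X.tgt l) := rfl

/-- The number of link variables fixed by a pair of conjugate gauge transformations at the ends of
the link. -/
theorem card_fixed_mul_card_carrier [Finite G] {a b : G} (h : IsConj a b) :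
    Nat.card {k : G // a⁻¹ * k * b = k} * Nat.card (ConjClasses.mk a).carrier = Nat.card G := by
  obtain ⟨c, rfl⟩ := isConj_iff.1 h
  -- The fixed-point equation says that `k * c` commutes with `a`, so the solutions are a translate
  -- of the centralizer; orbit-stabilizer then counts them.
  have e : {k : G // a⁻¹ * k * (c * a * c⁻¹) = k} ≃ MulAction.stabilizer (ConjAct G) a := by
    refine ((Equiv.mulRight c).trans ConjAct.toConjAct.toEquiv).subtypeEquiv fun k => ?_
    rw [MulAction.mem_stabilizer_iff]
    change _ ↔ (k * c) * a * (k * c)⁻¹ = a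
    rw [mul_assoc, inv_mul_eq_iff_eq_mul, ← mul_inv_eq_iff_eq_mul, mul_inv_rev]
    simp only [mul_assoc]
  rw [Nat.card_congr e, ← ConjAct.orbit_eq_carrier_conjClasses, Nat.card_coe_set_eq,
    ← MulAction.index_stabilizer, Subgroup.card_mul_index]
  rfl

theorem isConj_of_fixed {a b k : G} (h : a⁻¹ * k * b = k) : IsConj a b := by
  refine (isConj_iff.2 ⟨k, ?_⟩ : IsConj b a).symm
  rw [mul_inv_eq_iff_eq_mul, ← inv_mul_eq_iff_eq_mul, ← mul_assoc, h]

/-- The trace of a permutation representation counts fixed configurations, and the fixed-point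
condition decouples over the links. -/
theorem character_linkRep [Fintype G] [Fintype L] (X : Lattice S L) (g : S → G) :
    (linkRep G X).character g
      = ∏ l, (Nat.card {k : G // (g (X.src l))⁻¹ * k * g (X.tgt l) = k} : ℂ) := by
  classical
  rw [Representation.character, LinearMap.trace_eq_matrix_trace ℂ
    (EuclideanSpace.basisFun (L → G) ℂ).toBasis]
  have h : ∀ l, (Nat.card {k : G // (g (X.src l))⁻¹ * k * g (X.tgt l) = k} : ℂ)
      = ∑ k : G, if (g (X.src l))⁻¹ * k * g (X.tgt l) = k then 1 else 0 := by
    intro l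
    rw [Finset.sum_boole, Nat.card_eq_fintype_card, Fintype.card_subtype]
  simp only [h]
  rw [Finset.prod_univ_sum, Fintype.piFinset_univ]
  refine Finset.sum_congr rfl fun k _ => ?_
  rw [Matrix.diag_apply, LinearMap.toMatrix_apply]
  simp only [OrthonormalBasis.coe_toBasis, EuclideanSpace.basisFun_apply,
    OrthonormalBasis.coe_toBasis_repr_apply, EuclideanSpace.basisFun_repr, linkRep_apply,
    PiLp.single_apply, Finset.prod_ite_zero, Finset.prod_const_one, funext_iff,
    Finset.mem_univ, true_implies]

end Links

/-! ### The dimension of the physical Hilbert space -/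

section Dimension

theorem Lattice.Connected.eq_of_forall_link {S L : Type*} {X : Lattice S L} (hX : X.Connected)
    {α : Type*} {f : S → α} (hf : ∀ l, f (X.src l) = f (X.tgt l)) (x y : S) : f x = f y := by
  induction hX.2 x y with
  | rel x y h => obtain ⟨l, rfl, rfl⟩ := h; exact hf l
  | refl x => rfl
  | symm x y _ ih => exact ih.symm
  | trans x y z _ _ ih₁ ih₂ => exact ih₁.trans ih₂

variable {G : Type*} [Group G] {n : ℕ}

theorem det_one_add_conj {ρ : G →* Matrix.unitaryGroup (Fin n) ℂ} {a b : G} (h : IsConj a b) :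
    (1 + (ρ a : Matrix (Fin n) (Fin n) ℂ)).det = (1 + (ρ b : Matrix (Fin n) (Fin n) ℂ)).det := by
  obtain ⟨c, rfl⟩ := isConj_iff.1 h
  have hc : (ρ c : Matrix (Fin n) (Fin n) ℂ) * (ρ c⁻¹ : Matrix (Fin n) (Fin n) ℂ) = 1 := by
    rw [← Submonoid.coe_mul, ← map_mul, mul_inv_cancel, map_one]; rfl
  have h1 : 1 + (ρ (c * a * c⁻¹) : Matrix (Fin n) (Fin n) ℂ)
      = (ρ c : Matrix (Fin n) (Fin n) ℂ) * (1 + (ρ a : Matrix (Fin n) (Fin n) ℂ))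
        * (ρ c⁻¹ : Matrix (Fin n) (Fin n) ℂ) := by
    rw [mul_add, mul_one, add_mul, hc, map_mul, map_mul, Submonoid.coe_mul, Submonoid.coe_mul]
  rw [h1, Matrix.det_mul, Matrix.det_mul, mul_right_comm, ← Matrix.det_mul, hc, Matrix.det_one,
    one_mul]

/-- Sitewise conjugacy is conjugacy in the product group, which a character with commutative target
cannot see. -/
theorem character_const_of_forall_isConj {S : Type*} (τ : (S → G) →* ℂˣ) {g : S → G} {a : G}
    (h : ∀ x, IsConj a (g x)) : τ g = τ fun _ => a := by
  choose c hc using fun x => isConj_iff.1 (h x)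
  have hg : g = c * (fun _ => a) * c⁻¹ := funext fun x => (hc x).symm
  rw [hg, map_mul, map_mul, map_inv, mul_right_comm, mul_inv_cancel, one_mul]

variable [Fintype G] {S L : Type*} [Fintype S] [Fintype L] [Fintype (ConjClasses G)]

/-- Writing the character as a sum of class indicators allows the sums over gauge transformations
and over classes to be exchanged. -/
theorem character_linkRep_mul_trace {X : Lattice S L} (hX : X.Connected) (Ns : ℕ)
    (ρ : G →* Matrix.unitaryGroup (Fin n) ℂ) (τ : (S → G) →* ℂˣ) [DecidableEq (ConjClasses G)]
    (r : ConjClasses G → G) (hr : ∀ C, ConjClasses.mk (r C) = C) (g : S → G) :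
    (linkRep G X).character g
        * (τ g * ∏ x, (1 + (ρ (g x) : Matrix (Fin n) (Fin n) ℂ)).det ^ Ns)
      = ∑ C : ConjClasses G, if ∀ x, ConjClasses.mk (g x) = C then
          ((Nat.card G : ℂ) / Nat.card C.carrier) ^ Fintype.card L * (τ (fun _ => r C) *
            (1 + (ρ (r C) : Matrix (Fin n) (Fin n) ℂ)).det ^ (Ns * Fintype.card S)) else 0 := by
  obtain ⟨x₀⟩ := hX.1
  rw [character_linkRep]
  by_cases h : ∃ C, ∀ x, ConjClasses.mk (g x) = C
  · obtain ⟨C, hC⟩ := h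
    have hconj : ∀ x, IsConj (r C) (g x) := fun x =>
      ConjClasses.mk_eq_mk_iff_isConj.1 ((hr C).trans (hC x).symm)
    rw [Finset.sum_eq_single C, if_pos hC, character_const_of_forall_isConj τ hconj]
    · congr 1
      · rw [Finset.prod_eq_pow_card (b := (Nat.card G : ℂ) / Nat.card C.carrier),
          Finset.card_univ]
        intro l _
        have hl := card_fixed_mul_card_carrier ((hconj (X.src l)).symm.trans (hconj (X.tgt l)))
        rw [hC] at hl
        rw [← hl, Nat.cast_mul, mul_div_cancel_right₀]
        rw [← hC x₀]
        have : Nonempty (ConjClasses.mk (g x₀)).carrier := ⟨_, ConjClasses.mem_carrier_mk⟩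
        exact_mod_cast Nat.card_pos.ne'
      · congr 1
        rw [pow_mul, ← Finset.card_univ, ← Finset.prod_const]
        exact Finset.prod_congr rfl fun x _ => by rw [det_one_add_conj (hconj x)]
    · intro D _ hD
      exact if_neg fun h => hD ((h x₀).symm.trans (hC x₀))
    · simp
  · rw [Finset.sum_eq_zero fun C _ => if_neg fun hC => h ⟨C, hC⟩]
    -- By connectedness a nonconstant class must change across some link, and that link has no fixed
    -- value.
    obtain ⟨l, hl⟩ : ∃ l, ConjClasses.mk (g (X.src l)) ≠ ConjClasses.mk (g (X.tgt l)) := by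
      by_contra! hl
      exact h ⟨_, fun x => hX.eq_of_forall_link (f := fun x => ConjClasses.mk (g x)) hl x x₀⟩
    have : IsEmpty {k : G // (g (X.src l))⁻¹ * k * g (X.tgt l) = k} :=
      ⟨fun k => hl (ConjClasses.mk_eq_mk_iff_isConj.2 (isConj_of_fixed k.2))⟩
    rw [Finset.prod_eq_zero (Finset.mem_univ l) (by simp), zero_mul]

theorem finrank_physicalSpace [LinearOrder S] {X : Lattice S L} (hX : X.Connected) (Ns : ℕ)
    (ρ : G →* Matrix.unitaryGroup (Fin n) ℂ) (τ : (S → G) →* ℂˣ)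
    (r : ConjClasses G → G) (hr : ∀ C, ConjClasses.mk (r C) = C) :
    (Module.finrank ℂ (physicalSpace X (fockRep (modeRep S Ns ρ) τ)) : ℂ)
      = ∑ C : ConjClasses G,
          ((Nat.card G : ℂ) / (Nat.card C.carrier : ℂ))
              ^ ((Fintype.card L : ℤ) - (Fintype.card S : ℤ))
            * (τ (fun _ => r C) : ℂ)
            * (1 + (ρ (r C) : Matrix (Fin n) (Fin n) ℂ)).det ^ (Ns * Fintype.card S) := by
  classical
  have hG : (Nat.card G : ℂ) ≠ 0 := by exact_mod_cast Nat.card_pos.ne'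
  have hSG : (Nat.card (S → G) : ℂ) ≠ 0 := by exact_mod_cast Nat.card_pos.ne'
  let _ := invertibleOfNonzero hSG
  rw [physicalSpace, ← Representation.card_inv_mul_sum_char_eq_finrank, Representation.char_tensor]
  have htr := trace_fockRep_modeRep (S := S) Ns ρ τ
  simp only [Pi.mul_apply, (show ∀ g, (fockRep (modeRep S Ns ρ) τ).character g = _ from htr),
    character_linkRep_mul_trace hX Ns ρ τ r hr]
  rw [Finset.sum_comm, Finset.mul_sum]
  refine Finset.sum_congr rfl fun C _ => ?_
  have hC : (Nat.card C.carrier : ℂ) ≠ 0 := by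
    have : Nonempty C.carrier := ⟨r C, ConjClasses.mem_carrier_iff_mk_eq.2 (hr C)⟩
    exact_mod_cast Nat.card_pos.ne'
  have hcount : (Finset.univ.filter fun g : S → G => ∀ x, ConjClasses.mk (g x) = C).card
      = Nat.card C.carrier ^ Fintype.card S := by
    have : (Finset.univ.filter fun g : S → G => ∀ x, ConjClasses.mk (g x) = C)
        = Fintype.piFinset fun _ => Finset.univ.filter fun a => ConjClasses.mk a = C := by
      ext g; simp
    rw [this, Fintype.card_piFinset, Finset.prod_const, Finset.card_univ, ← Fintype.card_subtype,
      ← Nat.card_eq_fintype_card]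
    congr 1
    exact Nat.card_congr (Equiv.subtypeEquivRight fun x => ConjClasses.mem_carrier_iff_mk_eq.symm)
  rw [← Finset.sum_filter, Finset.sum_const, hcount, nsmul_eq_mul, zpow_sub₀ (div_ne_zero hG hC),
    zpow_natCast, zpow_natCast, Nat.card_fun, Nat.card_eq_fintype_card (α := S)]
  push_cast
  rw [div_pow (Nat.card G : ℂ) _ (Fintype.card S)]
  field_simp

end Dimension

/-! ### Non-vanishing of the physical Hilbert space -/

section Nonvanishing

variable {G : Type*} [Group G] {n : ℕ} {S L : Type*} [Fintype S] [LinearOrder S]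
  [Fintype L]

/-- A Fock vector invariant under all constant gauge transformations gives rise to a physical
state. -/
theorem finrank_physicalSpace_pos [Fintype G] {X : Lattice S L} (hX : X.Connected) {I : Type*} [Fintype I]
    (Γ : Representation ℂ (S → G) (Fock I)) {w : Fock I} (hw : w ≠ 0)
    (hinv : ∀ a : G, Γ (fun _ => a) w = w) : 0 < Module.finrank ℂ (physicalSpace X Γ) := by
  classical
  obtain ⟨x₀⟩ := hX.1
  let δ : GaugeSpace G L := EuclideanSpace.single 1 1
  -- Summing over the whole group makes the state invariant; it remains to exclude cancellation.
  let Ψ : GaugeSpace G L ⊗[ℂ] Fock I := ∑ g : S → G, (linkRep G X g δ) ⊗ₜ Γ g w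
  have hΨ : Ψ ∈ physicalSpace X Γ := by
    intro k
    simp only [Ψ, map_sum, Representation.tprod_apply, TensorProduct.map_tmul]
    refine Fintype.sum_equiv (Equiv.mulLeft k) _ _ fun g => ?_
    simp [Module.End.mul_apply]
  let ev : GaugeSpace G L ⊗[ℂ] Fock I →ₗ[ℂ] Fock I := TensorProduct.lift
    (LinearMap.lsmul ℂ (Fock I) ∘ₗ
      (EuclideanSpace.proj (1 : L → G) : GaugeSpace G L →L[ℂ] ℂ).toLinearMap)
  -- At the trivial link configuration only its stabilizer contributes. By connectedness this
  -- consists of constant transformations, each contributing exactly `w`.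
  have hev : ev Ψ = (Finset.univ.filter fun g : S → G =>
      (fun l => (g (X.src l))⁻¹ * g (X.tgt l)) = 1).card • w := by
    rw [← Finset.sum_const, Finset.sum_filter]
    simp only [Ψ, map_sum]
    refine Finset.sum_congr rfl fun g _ => ?_
    have : ev ((linkRep G X g δ) ⊗ₜ Γ g w) = (linkRep G X g δ 1) • Γ g w := rfl
    rw [this, linkRep_apply]
    simp only [δ, PiLp.single_apply, Pi.one_apply, mul_one]
    split_ifs with h
    · have hg : g = fun _ => g x₀ := funext fun x => hX.eq_of_forall_link
        (fun l => inv_mul_eq_one.1 (congrFun h l)) x x₀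
      rw [hg, hinv, one_smul]
    · rw [zero_smul]
  have hne : Ψ ≠ 0 := by
    intro h
    rw [h, map_zero, eq_comm, ← Nat.cast_smul_eq_nsmul ℂ, smul_eq_zero, Nat.cast_eq_zero,
      Finset.card_eq_zero] at hev
    refine (Finset.eq_empty_iff_forall_notMem.1 (hev.resolve_right hw) 1) ?_
    simp [Pi.one_def]
  have : Nontrivial (physicalSpace X Γ) :=
    ⟨⟨⟨Ψ, hΨ⟩, 0, fun h => hne (congrArg Subtype.val h)⟩⟩
  exact Module.finrank_pos

/-- An alternating map in `n` arguments on an `n`-dimensional space is a multiple of the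
determinant, so it is fixed by its value on the standard basis. -/
theorem ιMulti_comp_toLin' {W : Type*} [AddCommGroup W] [Module ℂ W]
    (M : Matrix (Fin n) (Fin n) ℂ) (f : (Fin n → ℂ) →ₗ[ℂ] W) :
    ExteriorAlgebra.ιMulti ℂ n (fun a => f (M.toLin' (Pi.single a 1)))
      = M.det • ExteriorAlgebra.ιMulti ℂ n (fun a => f (Pi.single a 1)) := by
  let ω := (ExteriorAlgebra.ιMulti ℂ n).compLinearMap f
  have h : ω = (LinearMap.toSpanSingleton ℂ _ (ω fun a => Pi.single a 1)).compAlternatingMap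
      (Pi.basisFun ℂ (Fin n)).det := by
    refine (Pi.basisFun ℂ (Fin n)).ext_alternating fun i hi => ?_
    let σ : Equiv.Perm (Fin n) := Equiv.ofBijective i (Finite.injective_iff_bijective.1 hi)
    change ω (Pi.basisFun ℂ (Fin n) ∘ σ) = LinearMap.toSpanSingleton ℂ _ _
      ((Pi.basisFun ℂ (Fin n)).det (Pi.basisFun ℂ (Fin n) ∘ σ))
    rw [AlternatingMap.map_perm, AlternatingMap.map_perm, Module.Basis.det_self]
    rw [LinearMap.toSpanSingleton_apply, smul_assoc, one_smul]
    congr 2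
    ext1 a
    exact Pi.basisFun_apply _ _ a
  have h2 := AlternatingMap.congr_fun h fun a => M.toLin' (Pi.single a 1)
  rw [LinearMap.compAlternatingMap_apply, LinearMap.toSpanSingleton_apply,
    Pi.basisFun_det_apply] at h2
  have h3 : (Matrix.of fun a => M.toLin' (Pi.single a 1)) = M.transpose := by
    ext; simp
  rw [h3, Matrix.det_transpose] at h2
  exact h2

/-- The mode with gauge index `a` at the given site and spinor index. -/
def mkMode {S : Type*} {Ns n : ℕ} (t : S × Fin Ns) (a : Fin n) : Modes S Ns n :=
  toLex (t.1, toLex (t.2, a))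

/-- The inclusion of the gauge multiplet at a given site and spinor index. -/
def multiplet {S : Type*} [DecidableEq S] {Ns n : ℕ} (t : S × Fin Ns) :
    (Fin n → ℂ) →ₗ[ℂ] (Modes S Ns n → ℂ) :=
  Fintype.linearCombination ℂ fun a => Pi.single (mkMode t a) 1

theorem multiplet_single {S : Type*} [DecidableEq S] {Ns n : ℕ} (t : S × Fin Ns) (a : Fin n) :
    multiplet t (Pi.single a 1) = Pi.single (mkMode t a) 1 := by
  simp [multiplet]

theorem toLin'_modeMatrix_single {G S : Type*} [Group G] [Fintype S] [DecidableEq S] (Ns : ℕ)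
    (ρ : G →* Matrix.unitaryGroup (Fin n) ℂ) (g : S → G) (t : S × Fin Ns) (a : Fin n) :
    (modeMatrix Ns ρ g).toLin' (Pi.single (mkMode t a) 1)
      = multiplet t ((ρ (g t.1) : Matrix (Fin n) (Fin n) ℂ).toLin' (Pi.single a 1)) := by
  ext m
  obtain ⟨⟨s, c⟩, rfl⟩ : ∃ q : (S × Fin Ns) × Fin n, m = mkMode q.1 q.2 :=
    ⟨(((ofLex m).1, (ofLex (ofLex m).2).1), (ofLex (ofLex m).2).2), rfl⟩
  have hinj : ∀ b, (mkMode s c = mkMode t b) ↔ (s.1 = t.1 ∧ s.2 = t.2) ∧ c = b := by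
    intro b
    simp [mkMode, Prod.ext_iff, and_assoc]
  have hl : (modeMatrix Ns ρ g).toLin' (Pi.single (mkMode t a) 1) (mkMode s c)
      = if s.1 = t.1 ∧ s.2 = t.2 then (ρ (g s.1) : Matrix (Fin n) (Fin n) ℂ) c a else 0 := by
    rw [Matrix.toLin'_apply, Matrix.mulVec_single_one]
    rfl
  rw [hl, multiplet, Fintype.linearCombination_apply, Finset.sum_apply]
  simp only [Pi.smul_apply, Pi.single_apply, hinj, Matrix.toLin'_apply, Matrix.mulVec_single_one,
    Matrix.col_apply, smul_eq_mul, mul_ite, mul_one, mul_zero]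
  by_cases h : s.1 = t.1 ∧ s.2 = t.2
  · simp [h]
  · simp [h]

/-- The exterior product of all modes of a gauge multiplet. -/
def filledMultiplet {S : Type*} [DecidableEq S] {Ns : ℕ} (n : ℕ) (t : S × Fin Ns) :
    ExteriorAlgebra ℂ (Modes S Ns n → ℂ) :=
  ExteriorAlgebra.ιMulti ℂ n fun a => Pi.single (mkMode t a) 1

theorem map_filledMultiplet (Ns : ℕ) (ρ : G →* Matrix.unitaryGroup (Fin n) ℂ) (g : S → G)
    (t : S × Fin Ns) :
    ExteriorAlgebra.map (modeMatrix Ns ρ g).toLin' (filledMultiplet n t)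
      = (ρ (g t.1) : Matrix (Fin n) (Fin n) ℂ).det • filledMultiplet n t := by
  rw [filledMultiplet, ExteriorAlgebra.map_apply_ιMulti]
  simp only [Function.comp_def, toLin'_modeMatrix_single]
  rw [ιMulti_comp_toLin']
  simp only [multiplet_single]

theorem map_prod_filledMultiplet (Ns : ℕ) (ρ : G →* Matrix.unitaryGroup (Fin n) ℂ) (a : G)
    (l : List (S × Fin Ns)) :
    ExteriorAlgebra.map (modeMatrix Ns ρ fun _ : S => a).toLin' (l.map (filledMultiplet n)).prod
      = (ρ a : Matrix (Fin n) (Fin n) ℂ).det ^ l.length • (l.map (filledMultiplet n)).prod := by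
  induction l with
  | nil => simp
  | cons t l ih =>
    rw [List.map_cons, List.prod_cons, map_mul, ih, map_filledMultiplet, smul_mul_smul_comm,
      List.length_cons, pow_succ']

/-- Filling `k` gauge multiplets produces a state on which the constant gauge transformations act by
the `k`-th power of the determinant. -/
theorem exists_secondQuantize_eq_det_pow_smul {Ns k : ℕ} (hk : k ≤ Ns * Fintype.card S)
    (ρ : G →* Matrix.unitaryGroup (Fin n) ℂ) :
    ∃ w : Fock (Modes S Ns n), w ≠ 0 ∧ ∀ a : G,
      secondQuantize (modeMatrix Ns ρ fun _ => a) w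
        = (ρ a : Matrix (Fin n) (Fin n) ℂ).det ^ k • w := by
  obtain ⟨T, -, hT⟩ := Finset.exists_subset_card_eq
    (s := (Finset.univ : Finset (S × Fin Ns))) (n := k) (by simpa [mul_comm] using hk)
  -- Listing the modes multiplet by multiplet makes the state a product of filled multiplets, each
  -- transforming by one determinant.
  let l : List (Modes S Ns n) := T.toList.flatMap fun t => (List.finRange n).map (mkMode t)
  have hl : l.Nodup := by
    rw [List.nodup_flatMap]
    refine ⟨fun t _ => (List.nodup_finRange n).map fun a b h => ?_, ?_⟩
    · simpa [mkMode] using h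
    · refine T.nodup_toList.imp fun {t u} htu => ?_
      rw [Function.onFun, List.disjoint_left]
      simp only [List.mem_map, List.mem_finRange, true_and, not_exists]
      rintro _ ⟨a, rfl⟩ b hb
      apply htu
      simp only [mkMode, EmbeddingLike.apply_eq_iff_eq, Prod.ext_iff] at hb
      exact Prod.ext hb.1.symm hb.2.1.symm
  have hfill : fockEquiv ((l.map create).prod vacuum) = (T.toList.map (filledMultiplet n)).prod := by
    rw [fockEquiv_prod_create, List.map_flatMap, List.flatMap, List.prod_flatten, List.map_map]
    congr 2
    ext1 t
    rw [filledMultiplet, ExteriorAlgebra.ιMulti_apply, List.ofFn_eq_map, Function.comp_apply,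
      List.map_map]
    rfl
  refine ⟨(l.map create).prod vacuum, prod_create_vacuum_ne_zero hl, fun a => ?_⟩
  apply fockEquiv.injective
  rw [fockEquiv_secondQuantize, hfill, map_prod_filledMultiplet, map_smul, hfill,
    Finset.length_toList, hT]

theorem finrank_physicalSpace_fockRep_pos [Fintype G] {X : Lattice S L} (hX : X.Connected) {Ns k : ℕ}
    (hk : k ≤ Ns * Fintype.card S) (ρ : G →* Matrix.unitaryGroup (Fin n) ℂ) (τ : (S → G) →* ℂˣ)
    (hτ : ∀ a : G, (τ (fun _ => a) : ℂ) = ((ρ a : Matrix (Fin n) (Fin n) ℂ).det⁻¹) ^ k) :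
    0 < Module.finrank ℂ (physicalSpace X (fockRep (modeRep S Ns ρ) τ)) := by
  obtain ⟨w, hw, h⟩ := exists_secondQuantize_eq_det_pow_smul hk ρ
  refine finrank_physicalSpace_pos hX _ hw fun a => ?_
  have hdet : (ρ a : Matrix (Fin n) (Fin n) ℂ).det ≠ 0 := by
    have := congrArg Matrix.det (Matrix.mem_unitaryGroup_iff'.1 (ρ a).2)
    rw [Matrix.det_mul, Matrix.det_one] at this
    exact right_ne_zero_of_mul_eq_one this
  rw [fockRep_apply, coe_modeRep, h, hτ, smul_smul, ← mul_pow, inv_mul_cancel₀ hdet, one_pow,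
    one_smul]

end Nonvanishing

end FiniteGauge

end

theorem mainTheorem3 {G : Type*} [Group G] [Fintype G] [DecidableEq G] {n : ℕ}
    (ρ : G →* Matrix.unitaryGroup (Fin n) ℂ)
    {S L : Type*} [Fintype S] [LinearOrder S] [Fintype L]
    (X : FiniteGauge.Lattice S L) (hX : X.Connected) (Ns : ℕ) :
    -- the character of the exterior algebra representation
    (∀ g, (FiniteGauge.exteriorRep (FiniteGauge.matrixRep ρ)).character g
        = (1 + (ρ g : Matrix (Fin n) (Fin n) ℂ)).det) ∧
    -- the gauge representation on the Fock space of a single spinless fermion multiplet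
    (∀ σ : G →* ℂˣ,
      (∃! Γ : Representation ℂ G (FiniteGauge.Fock (Fin n)),
        FiniteGauge.Implements (fun g => (ρ g).1) σ Γ) ∧
      ∀ Γ : Representation ℂ G (FiniteGauge.Fock (Fin n)),
        FiniteGauge.Implements (fun g => (ρ g).1) σ Γ →
        FiniteGauge.IsExterior (fun g => (ρ g).1) σ Γ ∧
        (∀ g, LinearMap.trace ℂ _ (Γ g)
          = σ g * (1 + (ρ g : Matrix (Fin n) (Fin n) ℂ)).det) ∧
        (∀ g, LinearMap.trace ℂ _ (Γ g ∘ₗ FiniteGauge.parity)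
          = σ g * (1 - (ρ g : Matrix (Fin n) (Fin n) ℂ)).det)) ∧
    -- the lattice theory; `τ` is the one-dimensional representation of the group of gauge
    -- transformations on the vacuum, and `g ↦ τ (fun _ => g)` its restriction to `G`
    (∀ τ : (S → G) →* ℂˣ,
      (∃! Γ : Representation ℂ (S → G) (FiniteGauge.Fock (FiniteGauge.Modes S Ns n)),
        FiniteGauge.Implements (FiniteGauge.modeMatrix Ns ρ) τ Γ) ∧
      ∀ Γ : Representation ℂ (S → G) (FiniteGauge.Fock (FiniteGauge.Modes S Ns n)),
        FiniteGauge.Implements (FiniteGauge.modeMatrix Ns ρ) τ Γ →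
        FiniteGauge.IsExterior (FiniteGauge.modeMatrix Ns ρ) τ Γ ∧
        (∀ g, LinearMap.trace ℂ _ (Γ g)
          = τ g * ∏ x, (1 + (ρ (g x) : Matrix (Fin n) (Fin n) ℂ)).det ^ Ns) ∧
        (∀ g, LinearMap.trace ℂ _ (Γ g ∘ₗ FiniteGauge.parity)
          = τ g * ∏ x, (1 - (ρ (g x) : Matrix (Fin n) (Fin n) ℂ)).det ^ Ns) ∧
        -- the number of gauge-invariant states, for any choice `r` of class representatives
        (∀ r : ConjClasses G → G, (∀ C, ConjClasses.mk (r C) = C) →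
          (Module.finrank ℂ (FiniteGauge.physicalSpace X Γ) : ℂ)
            = ∑ C : ConjClasses G,
                ((Nat.card G : ℂ) / (Nat.card C.carrier : ℂ))
                    ^ ((Fintype.card L : ℤ) - (Fintype.card S : ℤ))
                  * (τ (fun _ => r C) : ℂ)
                  * (1 + (ρ (r C) : Matrix (Fin n) (Fin n) ℂ)).det ^ (Ns * Fintype.card S)) ∧
        -- it is never zero for the invariant vacuum (`k = 0`) and for staggered vacua
        (∀ k ≤ Ns * Fintype.card S,
          (∀ g : G, (τ (fun _ => g) : ℂ) = ((ρ g : Matrix (Fin n) (Fin n) ℂ).det⁻¹) ^ k) →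
          0 < Module.finrank ℂ (FiniteGauge.physicalSpace X Γ))) := by
  refine ⟨fun g => FiniteGauge.trace_exteriorAlgebra_map _, fun σ =>
    ⟨FiniteGauge.existsUnique_implements ρ σ, fun Γ hΓ => ?_⟩, fun τ =>
    ⟨FiniteGauge.existsUnique_implements (FiniteGauge.modeRep S Ns ρ) τ, fun Γ hΓ => ?_⟩⟩
  -- Uniqueness replaces `Γ` by the explicit model, where the remaining claims are already known.
  · obtain rfl := FiniteGauge.Implements.eq_fockRep (U := ρ) hΓ
    exact ⟨FiniteGauge.isExterior_fockRep ρ σ, FiniteGauge.trace_fockRep ρ σ,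
      FiniteGauge.trace_fockRep_parity ρ σ⟩
  · obtain rfl := FiniteGauge.Implements.eq_fockRep (U := FiniteGauge.modeRep S Ns ρ) hΓ
    exact ⟨FiniteGauge.isExterior_fockRep (FiniteGauge.modeRep S Ns ρ) τ,
      FiniteGauge.trace_fockRep_modeRep Ns ρ τ, FiniteGauge.trace_fockRep_modeRep_parity Ns ρ τ,
      FiniteGauge.finrank_physicalSpace hX Ns ρ τ,
      fun k hk hτ => FiniteGauge.finrank_physicalSpace_fockRep_pos hX hk ρ τ hτ⟩
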